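/- Let $B$ be a real separable F-space (a real topological vector space whose topology is given by a translation-invariant, complete, separable metric), let $X$ be a $B$-valued random vector on a probability space $(\Omega,\mathcal F,P)$, measurable with respect to the Borel sets of $B$, and let $\mu$ be its law. Let $t_k : B\to\mathbb{R}$, $k\ge 1$, be Borel measurable functionals (not necessarily linear or continuous) such that the random variables $t_k(X)$, $k\ge1$, are independent and symmetric about $0$, with variances $\sigma_k^2\in(0,\infty)$. For a family $\mathcal T$ of real measurable functionals on a measurable space $E$, a probability measure $\nu$ on $E$ and $b\in E$, put $$HD_{\mathcal T}(b,\nu)=\inf_{t\in\mathcal T}\nu\{x\in E: t(x)\ge t(b)\},$$ and write $HD_{\mathbb{R}^d}$ when $E=\mathbb{R}^d$ and $\mathcal T$ consists of all linear functionals on $\mathbb{R}^d$. Let $a\in B$, and assume that (A-I) and (A-II) hold, or that (A-III) holds, where: (A-I) for every integer $d\ge1$, $HD_{\mathbb{R}^d}(\Pi_d(a),\mu\circ\Pi_d^{-1})>0$, where $\Pi_d(x)=(t_1(x),\dots,t_d(x))$ for $x\in B$; (A-II) there is a constant $c<\infty$ such that $\mathbb{E}(t_k(X)^4)\le c\,[\mathbb{E}(t_k(X)^2)]^2$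 for all $k\ge1$; (A-III) there are numbers $0<\lambda_k<\infty$ such that the random variables $t_k(X)/\lambda_k$, $k\ge1$, are i.i.d. with a probability density $\phi$ that is positive almost everywhere, absolutely continuous on every compact interval, and satisfies $\int_{\mathbb{R}}\frac{(\phi'(x))^2}{\phi(x)}\,dx<\infty$ and $\int_{\mathbb{R}}x^2\phi(x)\,dx<\infty$. Let $\mathcal T$ be the set of all finite real linear combinations of the $t_k$, $k\ge1$. Then $$HD_{\mathcal T}(a,\mu)>0\quad\text{if and only if}\quad\sum_{k\ge1}\frac{t_k(a)^2}{\sigma_k^2}<\infty.$$ -/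

import Mathlib

open MeasureTheory ProbabilityTheory

/-- The half-space depth of `a` with respect to a family `T` of real functionals on `E` and a
measure `μ`: the infimum over `t ∈ T` of `μ {x | t x ≥ t a}`. -/
noncomputable def halfSpaceDepth {E : Type*} [MeasurableSpace E] (T : Set (E → ℝ)) (a : E)
    (μ : Measure E) : ENNReal :=
  ⨅ t ∈ T, μ {x | t a ≤ t x}

/-- Tukey's half-space depth on `ℝ^d`, computed with all linear functionals. -/
noncomputable def tukeyDepth (d : ℕ) (a : Fin d → ℝ) (μ : Measure (Fin d → ℝ)) : ENNReal :=
  halfSpaceDepth (Set.range fun l : (Fin d → ℝ) →ₗ[ℝ] ℝ => (l : (Fin d → ℝ) → ℝ)) a μ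

/-- All finite (real) linear combinations of the functionals `t k`. -/
def finiteCombinations {E : Type*} (t : ℕ → E → ℝ) : Set (E → ℝ) :=
  (Submodule.span ℝ (Set.range t) : Set (E → ℝ))

/-- For every `d ≥ 1`, the vector `(t 0 a, …, t (d - 1) a)` has positive Tukey depth with respect
to the image of `μ` under `x ↦ (t 0 x, …, t (d - 1) x)`. -/
def PositiveFiniteDimDepth {E : Type*} [MeasurableSpace E] (t : ℕ → E → ℝ) (a : E)
    (μ : Measure E) : Prop :=
  ∀ d : ℕ, 1 ≤ d →
    0 < tukeyDepth d (fun i : Fin d => t i a) (μ.map fun x => fun i : Fin d => t i x)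

/-- The fourth moments of the random variables `Y k` are finite and bounded by a common multiple
of the squares of the second moments. -/
def FourthMomentBound {Ω : Type*} [MeasurableSpace Ω] (P : Measure Ω) (Y : ℕ → Ω → ℝ) : Prop :=
  ∃ c : ℝ, ∀ k, Integrable (fun ω => Y k ω ^ 4) P ∧
    ∫ ω, Y k ω ^ 4 ∂P ≤ c * (∫ ω, Y k ω ^ 2 ∂P) ^ 2

/-- `φ` is a nonnegative function on `ℝ` that is positive almost everywhere, absolutely continuous
on every compact interval, with finite Fisher information `∫ (φ')² / φ` and finite second moment
`∫ x² φ(x) dx`. As `φ` is differentiable and positive almost everywhere, the values of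
`(deriv φ x) ^ 2 / φ x` at the other points do not matter. -/
structure IsRegularDensity (φ : ℝ → ℝ) : Prop where
  nonneg : ∀ x, 0 ≤ φ x
  pos_ae : ∀ᵐ x, 0 < φ x
  absolutelyContinuous : ∀ a b : ℝ, AbsolutelyContinuousOnInterval φ a b
  fisher_lt_top : ∫⁻ x, ENNReal.ofReal ((deriv φ x) ^ 2 / φ x) < ⊤
  secondMoment_lt_top : ∫⁻ x, ENNReal.ofReal (x ^ 2 * φ x) < ⊤

/-- For some scales `0 < lam k < ∞`, the variables `Y k / lam k` are independent and all have the
law with density `φ`, where `φ` is as in `IsRegularDensity`. -/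
def ScaledIIDRegularDensity {Ω : Type*} [MeasurableSpace Ω] (P : Measure Ω) (Y : ℕ → Ω → ℝ) :
    Prop :=
  ∃ (lam : ℕ → ℝ) (φ : ℝ → ℝ), (∀ k, 0 < lam k) ∧ IsRegularDensity φ ∧
    iIndepFun (fun k ω => Y k ω / lam k) P ∧
    ∀ k, HasLaw (fun ω => Y k ω / lam k) (volume.withDensity fun x => ENNReal.ofReal (φ x)) P


/-!
Necessity is Markov's inequality applied to the combination `∑ t k a / σ k ^ 2 * t k`, whose
value at `a` is the partial sum `S` of the series and whose second moment is again `S`.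

For sufficiency, split a combination into a head, over the first `d` indices, and a tail. The two
are independent, so it is enough to bound each of the two half-space probabilities from below.
The head is controlled by the finite-dimensional depth. If `d` is large, then by Cauchy–Schwarz
the tail has at `a` a value below any prescribed fraction of its standard deviation, and the
probability to exceed a fixed fraction of the standard deviation is bounded below uniformly: under a
fourth moment bound this is the Paley–Zygmund inequality. In the identically distributed case the
fourth moment bound holds after a symmetric truncation, and truncating symmetric summands at most
doubles the half-space probabilities.
-/

section Moments

variable {Ω ι : Type*} [MeasurableSpace Ω] {P : Measure Ω}

theorem memLp_natCast_iff_integrable_pow {n : ℕ} (hn : Even n) (hn0 : n ≠ 0) {f : Ω → ℝ}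
    (hf : AEStronglyMeasurable f P) : MemLp f n P ↔ Integrable (fun ω => f ω ^ n) P := by
  rw [← integrable_norm_rpow_iff hf (by exact_mod_cast hn0) (ENNReal.natCast_ne_top n)]
  simp only [ENNReal.toReal_natCast, Real.rpow_natCast, Real.norm_eq_abs, hn.pow_abs]

theorem integrable_pow_of_memLp [IsFiniteMeasure P] {n k : ℕ} (hk : k ≤ n) {f : Ω → ℝ}
    (hf : MemLp f n P) : Integrable (fun ω => f ω ^ k) P := by
  have hmeas : AEStronglyMeasurable (fun ω => f ω ^ k) P := hf.1.pow k
  rw [← integrable_norm_iff hmeas]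
  simpa only [norm_pow] using (hf.mono_exponent (by exact_mod_cast hk)).integrable_norm_pow'

theorem sq_integral_mul_le {f g : Ω → ℝ} (hf : MemLp f 2 P) (hg : MemLp g 2 P) :
    (∫ ω, f ω * g ω ∂P) ^ 2 ≤ (∫ ω, f ω ^ 2 ∂P) * ∫ ω, g ω ^ 2 ∂P := by
  have hfg : Integrable (fun ω => f ω * g ω) P := hf.integrable_mul hg
  have hquad (x : ℝ) : ∫ ω, (f ω + x * g ω) ^ 2 ∂P =
      (∫ ω, g ω ^ 2 ∂P) * (x * x) + 2 * (∫ ω, f ω * g ω ∂P) * x + ∫ ω, f ω ^ 2 ∂P := by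
    have hexp (ω : Ω) : (f ω + x * g ω) ^ 2 =
        f ω ^ 2 + (2 * x * (f ω * g ω) + x ^ 2 * g ω ^ 2) := by ring
    have hlin := hfg.const_mul (2 * x)
    have hsq := hg.integrable_sq.const_mul (x ^ 2)
    have hsum : Integrable (fun ω => 2 * x * (f ω * g ω) + x ^ 2 * g ω ^ 2) P := hlin.add hsq
    simp_rw [hexp]
    rw [integral_add hf.integrable_sq hsum, integral_add hlin hsq,
      integral_const_mul, integral_const_mul]
    ring
  have hdiscrim := discrim_le_zero fun x =>
    (integral_nonneg fun ω => sq_nonneg (f ω + x * g ω)).trans_eq (hquad x)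
  rw [discrim] at hdiscrim
  linarith

theorem paley_zygmund [IsProbabilityMeasure P] {Z : Ω → ℝ} (hm : Measurable Z)
    (hZ : MemLp Z 2 P) (hmean : 0 ≤ ∫ ω, Z ω ∂P) {θ : ℝ} (hθ0 : 0 ≤ θ) (hθ1 : θ ≤ 1) :
    ((1 - θ) * ∫ ω, Z ω ∂P) ^ 2 ≤
      (∫ ω, Z ω ^ 2 ∂P) * P.real {ω | θ * ∫ ω, Z ω ∂P ≤ Z ω} := by
  set m := ∫ ω, Z ω ∂P
  set A := {ω | θ * m ≤ Z ω}
  have hA : MeasurableSet A := measurableSet_le measurable_const hm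
  have hind : MemLp (A.indicator fun _ => (1 : ℝ)) 2 P :=
    (memLp_const 1).indicator hA
  have hZint : Integrable Z P := hZ.integrable one_le_two
  have hle : (1 - θ) * m ≤ ∫ ω, Z ω * A.indicator (fun _ => 1) ω ∂P := by
    calc (1 - θ) * m = ∫ ω, (Z ω - θ * m) ∂P := by
          rw [integral_sub hZint (integrable_const _)]
          simp [m, sub_mul]
      _ ≤ ∫ ω, Z ω * A.indicator (fun _ => 1) ω ∂P := by
          refine integral_mono (hZint.sub (integrable_const _)) (hZ.integrable_mul hind)
            fun ω => ?_
          by_cases hω : ω ∈ A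
          · simpa [hω] using mul_nonneg hθ0 hmean
          · simpa [hω] using (not_le.1 hω).le
  have hsq : ∫ ω, A.indicator (fun _ => (1 : ℝ)) ω ^ 2 ∂P = P.real A := by
    rw [← integral_indicator_one hA]
    congr with ω
    by_cases hω : ω ∈ A <;> simp [hω]
  calc ((1 - θ) * m) ^ 2 ≤ (∫ ω, Z ω * A.indicator (fun _ => 1) ω ∂P) ^ 2 :=
        pow_le_pow_left₀ (mul_nonneg (sub_nonneg.2 hθ1) hmean) hle 2
    _ ≤ _ := by simpa only [hsq] using sq_integral_mul_le hZ hind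

theorem integral_eq_zero_of_identDistrib_neg {Z : Ω → ℝ}
    (h : IdentDistrib Z (fun ω => -Z ω) P P) : ∫ ω, Z ω ∂P = 0 := by
  have hneg := h.integral_eq
  rw [integral_neg] at hneg
  linarith

theorem measureReal_le_sq_le_two_mul_of_identDistrib_neg [IsFiniteMeasure P] {Z : Ω → ℝ}
    (h : IdentDistrib Z (fun ω => -Z ω) P P) {r : ℝ} (hr : 0 ≤ r) :
    P.real {ω | r ^ 2 ≤ Z ω ^ 2} ≤ 2 * P.real {ω | r ≤ Z ω} := by
  have hneg : P.real {ω | r ≤ -Z ω} = P.real {ω | r ≤ Z ω} :=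
    congrArg ENNReal.toReal (h.measure_mem_eq (measurableSet_Ici (a := r))).symm
  have hsub : {ω | r ^ 2 ≤ Z ω ^ 2} ⊆ {ω | r ≤ Z ω} ∪ {ω | r ≤ -Z ω} := fun ω hω =>
    le_abs.1 ((abs_of_nonneg hr).symm.trans_le (sq_le_sq.1 hω))
  calc _ ≤ P.real {ω | r ≤ Z ω} + P.real {ω | r ≤ -Z ω} :=
        (measureReal_mono hsub).trans (measureReal_union_le _ _)
    _ = _ := by rw [hneg, two_mul]

theorem le_measureReal_half_sqrt_le_of_pow_four_le [IsProbabilityMeasure P] {Z : Ω → ℝ}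
    (hm : Measurable Z) (hsymm : IdentDistrib Z (fun ω => -Z ω) P P) (h4 : MemLp Z 4 P) {C : ℝ}
    (hC : 1 ≤ C) (hb : ∫ ω, Z ω ^ 4 ∂P ≤ C * (∫ ω, Z ω ^ 2 ∂P) ^ 2) :
    9 / (32 * C) ≤ P.real {ω | 1 / 2 * √(∫ ω, Z ω ^ 2 ∂P) ≤ Z ω} := by
  set m := ∫ ω, Z ω ^ 2 ∂P
  have hm0 : 0 ≤ m := integral_nonneg fun ω => sq_nonneg _
  have hpow (ω : Ω) : (Z ω ^ 2) ^ 2 = Z ω ^ 4 := by ring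
  have hZ2 : MemLp (fun ω => Z ω ^ 2) 2 P :=
    (memLp_two_iff_integrable_sq (hm.pow_const 2).aestronglyMeasurable).2
      (by simpa only [hpow] using integrable_pow_of_memLp le_rfl h4)
  have hthreshold : (1 / 2 * √m) ^ 2 = 1 / 4 * m := by
    rw [mul_pow, Real.sq_sqrt hm0]
    norm_num
  have hsq : 9 / 16 ≤ C * P.real {ω | 1 / 4 * m ≤ Z ω ^ 2} := by
    rcases hm0.eq_or_lt with h0 | hpos
    · have huniv : {ω | 1 / 4 * m ≤ Z ω ^ 2} = Set.univ :=
        Set.eq_univ_of_forall fun ω => by simp [← h0, sq_nonneg]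
      rw [huniv, probReal_univ]
      linarith
    · have hpz := paley_zygmund (hm.pow_const 2) hZ2 hm0 (θ := 1 / 4) (by norm_num) (by norm_num)
      simp only [hpow] at hpz
      have hscaled : m ^ 2 * (9 / 16) ≤ m ^ 2 * (C * P.real {ω | 1 / 4 * m ≤ Z ω ^ 2}) := by
        linarith [mul_le_mul_of_nonneg_right hb
          (measureReal_nonneg (μ := P) (s := {ω | 1 / 4 * m ≤ Z ω ^ 2}))]
      exact le_of_mul_le_mul_left hscaled (by positivity)
  have hhalf := measureReal_le_sq_le_two_mul_of_identDistrib_neg hsymm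
    (r := 1 / 2 * √m) (by positivity)
  rw [hthreshold] at hhalf
  rw [div_le_iff₀ (by positivity)]
  linarith [mul_le_mul_of_nonneg_left hhalf (zero_le_one.trans hC)]

theorem integral_add_pow_four_of_indepFun [IsProbabilityMeasure P] {S X : Ω → ℝ}
    (hS : MemLp S 4 P) (hX : MemLp X 4 P) (hind : S ⟂ᵢ[P] X)
    (hS0 : ∫ ω, S ω ∂P = 0) (hX0 : ∫ ω, X ω ∂P = 0) :
    ∫ ω, (S ω + X ω) ^ 4 ∂P = ∫ ω, S ω ^ 4 ∂P +
      6 * ((∫ ω, S ω ^ 2 ∂P) * ∫ ω, X ω ^ 2 ∂P) + ∫ ω, X ω ^ 4 ∂P := by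
  have hpow (i j : ℕ) : (fun ω => S ω ^ i) ⟂ᵢ[P] (fun ω => X ω ^ j) :=
    hind.comp (measurable_id.pow_const i) (measurable_id.pow_const j)
  have hint {i j : ℕ} (hi : i ≤ 4) (hj : j ≤ 4) : Integrable (fun ω => S ω ^ i * X ω ^ j) P :=
    (hpow i j).integrable_mul (integrable_pow_of_memLp hi hS) (integrable_pow_of_memLp hj hX)
  have hmul (i j : ℕ) :
      ∫ ω, S ω ^ i * X ω ^ j ∂P = (∫ ω, S ω ^ i ∂P) * ∫ ω, X ω ^ j ∂P :=
    (hpow i j).integral_fun_mul_eq_mul_integral (hS.1.pow i) (hX.1.pow j)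
  calc ∫ ω, (S ω + X ω) ^ 4 ∂P
      = ∫ ω, ∑ i ∈ Finset.range 5, S ω ^ i * X ω ^ (4 - i) * (Nat.choose 4 i : ℝ) ∂P := by
        simp_rw [add_pow]
    _ = ∑ i ∈ Finset.range 5,
          (∫ ω, S ω ^ i ∂P) * (∫ ω, X ω ^ (4 - i) ∂P) * (Nat.choose 4 i : ℝ) := by
        rw [integral_finsetSum _ fun i hi =>
          (hint (Finset.mem_range_succ_iff.1 hi) (Nat.sub_le 4 i)).mul_const _]
        simp_rw [integral_mul_const, hmul]
    _ = _ := by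
        simp only [Finset.sum_range_succ, Finset.range_zero, Finset.sum_empty, Nat.choose, pow_zero,
          pow_one, integral_const, probReal_univ, smul_eq_mul, Nat.reduceSub, Nat.reduceAdd,
          Nat.cast_ofNat, hS0, hX0]
        ring

theorem indepFun_sum_mul_sum_mul {Y : ι → Ω → ℝ} (hm : ∀ i, Measurable (Y i))
    (hind : iIndepFun Y P) {s u : Finset ι} (hsu : Disjoint s u) (c : ι → ℝ) :
    (fun ω => ∑ i ∈ s, c i * Y i ω) ⟂ᵢ[P] (fun ω => ∑ i ∈ u, c i * Y i ω) := by
  have hmeas (v : Finset ι) : Measurable fun x : v → ℝ => ∑ i : v, c i * x i := by fun_prop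
  have hcomp := (hind.indepFun_finset s u hsu hm).comp (hmeas s) (hmeas u)
  have hsum (v : Finset ι) : (fun x : v → ℝ => ∑ i : v, c i * x i) ∘ (fun ω (i : v) => Y i ω) =
      fun ω => ∑ i ∈ v, c i * Y i ω :=
    funext fun ω => Finset.sum_coe_sort v fun i => c i * Y i ω
  rwa [hsum, hsum] at hcomp

theorem integral_sum_mul_eq_zero {Y : ι → Ω → ℝ} (hint : ∀ i, Integrable (Y i) P)
    (h0 : ∀ i, ∫ ω, Y i ω ∂P = 0) (s : Finset ι) (c : ι → ℝ) :
    ∫ ω, ∑ i ∈ s, c i * Y i ω ∂P = 0 := by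
  rw [integral_finsetSum _ fun i _ => (hint i).const_mul _]
  simp [integral_const_mul, h0]

theorem integral_sq_sum_mul [IsFiniteMeasure P] {Y : ι → Ω → ℝ}
    (hind : Pairwise fun i j => Y i ⟂ᵢ[P] Y j)
    (h2 : ∀ i, MemLp (Y i) 2 P) (h0 : ∀ i, ∫ ω, Y i ω ∂P = 0) (s : Finset ι) (c : ι → ℝ) :
    ∫ ω, (∑ i ∈ s, c i * Y i ω) ^ 2 ∂P = ∑ i ∈ s, c i ^ 2 * ∫ ω, Y i ω ^ 2 ∂P := by
  have hL2 (i : ι) : MemLp (fun ω => c i * Y i ω) 2 P := (h2 i).const_mul (c i)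
  have hsum : (∑ i ∈ s, fun ω => c i * Y i ω) = fun ω => ∑ i ∈ s, c i * Y i ω := by
    ext ω
    exact Finset.sum_apply ω s _
  have hvar := IndepFun.variance_sum (s := s) (fun i _ => hL2 i) fun i _ j _ hij =>
    (hind hij).comp (measurable_const_mul (c i)) (measurable_const_mul (c j))
  rw [hsum, variance_of_integral_eq_zero (memLp_finsetSum s fun i _ => hL2 i).1.aemeasurable
    (integral_sum_mul_eq_zero (fun i => (h2 i).integrable one_le_two) h0 s c)] at hvar
  rw [hvar]
  refine Finset.sum_congr rfl fun i _ => ?_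
  rw [variance_const_mul, variance_of_integral_eq_zero (h2 i).1.aemeasurable (h0 i)]

theorem integral_pow_four_sum_mul_le [IsProbabilityMeasure P] {Y : ι → Ω → ℝ}
    (hm : ∀ i, Measurable (Y i)) (hind : iIndepFun Y P) (h4 : ∀ i, MemLp (Y i) 4 P)
    (h0 : ∀ i, ∫ ω, Y i ω ∂P = 0) {C : ℝ} (hC : 3 ≤ C)
    (hb : ∀ i, ∫ ω, Y i ω ^ 4 ∂P ≤ C * (∫ ω, Y i ω ^ 2 ∂P) ^ 2) (s : Finset ι) (c : ι → ℝ) :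
    ∫ ω, (∑ i ∈ s, c i * Y i ω) ^ 4 ∂P ≤ C * (∑ i ∈ s, c i ^ 2 * ∫ ω, Y i ω ^ 2 ∂P) ^ 2 := by
  classical
  induction s using Finset.induction_on with
  | empty => simp
  | insert i s hi ih =>
    have h2 (j : ι) : MemLp (Y j) 2 P := (h4 j).mono_exponent (by norm_num)
    have hI : (fun ω => ∑ j ∈ s, c j * Y j ω) ⟂ᵢ[P] (fun ω => c i * Y i ω) := by
      simpa using indepFun_sum_mul_sum_mul hm hind (Finset.disjoint_singleton_right.2 hi) c
    have hexp := integral_add_pow_four_of_indepFun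
      (memLp_finsetSum s fun j _ => (h4 j).const_mul (c j)) ((h4 i).const_mul (c i)) hI
      (integral_sum_mul_eq_zero (fun j => (h2 j).integrable one_le_two) h0 s c)
      (by rw [integral_const_mul, h0, mul_zero])
    rw [integral_sq_sum_mul (fun _ _ => hind.indepFun) h2 h0] at hexp
    simp only [mul_pow, integral_const_mul] at hexp
    simp_rw [Finset.sum_insert hi, add_comm (c i * Y i _)]
    rw [hexp]
    set v := ∑ j ∈ s, c j ^ 2 * ∫ ω, Y j ω ^ 2 ∂P
    set w := ∫ ω, Y i ω ^ 2 ∂P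
    have : 0 ≤ v := Finset.sum_nonneg fun j _ =>
      mul_nonneg (sq_nonneg _) (integral_nonneg fun ω => sq_nonneg _)
    have : 0 ≤ w := integral_nonneg fun ω => sq_nonneg _
    calc _ ≤ C * v ^ 2 + 2 * C * (v * (c i ^ 2 * w)) + c i ^ 4 * (C * w ^ 2) := by
          gcongr
          · linarith
          · exact hb i
      _ = C * (c i ^ 2 * w + v) ^ 2 := by ring

end Moments

section SymmetricSums

variable {Ω ι : Type*} [MeasurableSpace Ω] {P : Measure Ω}

theorem identDistrib_sum_mul {Y Y' : ι → Ω → ℝ} (hY : iIndepFun Y P) (hY' : iIndepFun Y' P)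
    (h : ∀ i, IdentDistrib (Y i) (Y' i) P P) (s : Finset ι) (c : ι → ℝ) :
    IdentDistrib (fun ω => ∑ i ∈ s, c i * Y i ω) (fun ω => ∑ i ∈ s, c i * Y' i ω) P P := by
  have hmeas : Measurable fun x : s → ℝ => ∑ i : s, c i * x i := by fun_prop
  have hcomp := (IdentDistrib.pi (fun i : s => h i) (hY.precomp Subtype.val_injective)
    (hY'.precomp Subtype.val_injective)).comp hmeas
  have hsum (V : ι → Ω → ℝ) : (fun x : s → ℝ => ∑ i : s, c i * x i) ∘ (fun ω (i : s) => V i ω) =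
      fun ω => ∑ i ∈ s, c i * V i ω :=
    funext fun ω => Finset.sum_coe_sort s fun i => c i * V i ω
  simpa only [hsum] using hcomp

theorem identDistrib_neg_sum_mul {Y : ι → Ω → ℝ} (hY : iIndepFun Y P)
    (h : ∀ i, IdentDistrib (Y i) (fun ω => -Y i ω) P P) (s : Finset ι) (c : ι → ℝ) :
    IdentDistrib (fun ω => ∑ i ∈ s, c i * Y i ω) (fun ω => -∑ i ∈ s, c i * Y i ω) P P := by
  have hneg : iIndepFun (fun i ω => -Y i ω) P := hY.comp (fun _ x => -x) fun _ => measurable_neg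
  simpa only [mul_neg, Finset.sum_neg_distrib] using identDistrib_sum_mul hY hneg h s c

theorem identDistrib_neg_indicator {Z : Ω → ℝ} (h : IdentDistrib Z (fun ω => -Z ω) P P)
    {D : Set ℝ} (hD : MeasurableSet D) (hneg : ∀ y, -y ∈ D ↔ y ∈ D) :
    IdentDistrib (fun ω => D.indicator id (Z ω)) (fun ω => -D.indicator id (Z ω)) P P := by
  have hodd (y : ℝ) : D.indicator id (-y) = -D.indicator id y := by
    by_cases hy : y ∈ D <;> simp [hneg, hy]
  simpa only [Function.comp_def, hodd] using h.comp (measurable_id.indicator hD)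

/- `2 * D.indicator id y - y` is `y` on `D` and `-y` off `D`. -/
theorem identDistrib_two_mul_indicator_sub {Z : Ω → ℝ} (hm : Measurable Z)
    (h : IdentDistrib Z (fun ω => -Z ω) P P) {D : Set ℝ} (hD : MeasurableSet D)
    (hneg : ∀ y, -y ∈ D ↔ y ∈ D) :
    IdentDistrib Z (fun ω => 2 * D.indicator id (Z ω) - Z ω) P P := by
  have hreflect : Measurable fun ω => 2 * D.indicator id (Z ω) - Z ω :=
    (((measurable_id.indicator hD).comp hm).const_mul 2).sub hm
  refine ⟨hm.aemeasurable, hreflect.aemeasurable, ?_⟩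
  ext B hB
  rw [Measure.map_apply hm hB, Measure.map_apply hreflect hB,
    ← measure_inter_add_sdiff _ (hm hD),
    ← measure_inter_add_sdiff ((fun ω => 2 * D.indicator id (Z ω) - Z ω) ⁻¹' B) (hm hD)]
  congr 1
  · congr 1
    ext ω
    simp only [Set.mem_inter_iff, Set.mem_preimage, and_congr_left_iff]
    intro hω
    simp [hω, two_mul]
  · have hoff : (fun ω => -Z ω) ⁻¹' (B \ D) =
        (fun ω => 2 * D.indicator id (Z ω) - Z ω) ⁻¹' B \ Z ⁻¹' D := by
      ext ω
      simp only [Set.mem_sdiff, Set.mem_preimage, hneg, and_congr_left_iff]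
      intro hω
      simp [hω]
    rw [← hoff]
    exact h.measure_mem_eq (hB.diff hD)

theorem measureReal_le_sum_mul_indicator_le [IsFiniteMeasure P] {Y : ι → Ω → ℝ}
    (hm : ∀ i, Measurable (Y i)) (hind : iIndepFun Y P)
    (hsymm : ∀ i, IdentDistrib (Y i) (fun ω => -Y i ω) P P) {D : ι → Set ℝ}
    (hD : ∀ i, MeasurableSet (D i)) (hneg : ∀ i y, -y ∈ D i ↔ y ∈ D i)
    (s : Finset ι) (c : ι → ℝ) (r : ℝ) :
    P.real {ω | r ≤ ∑ i ∈ s, c i * (D i).indicator id (Y i ω)} ≤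
      2 * P.real {ω | r ≤ ∑ i ∈ s, c i * Y i ω} := by
  let Y' : ι → Ω → ℝ := fun i ω => 2 * (D i).indicator id (Y i ω) - Y i ω
  have hY' : iIndepFun Y' P := hind.comp (fun i y => 2 * (D i).indicator id y - y) fun i =>
    ((measurable_id.indicator (hD i)).const_mul 2).sub measurable_id
  have hident := identDistrib_sum_mul hind hY'
    (fun i => identDistrib_two_mul_indicator_sub (hm i) (hsymm i) (hD i) (hneg i)) s c
  have hprob : P.real {ω | r ≤ ∑ i ∈ s, c i * Y' i ω} = P.real {ω | r ≤ ∑ i ∈ s, c i * Y i ω} :=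
    congrArg ENNReal.toReal (hident.measure_mem_eq (measurableSet_Ici (a := r))).symm
  have havg (ω : Ω) : ∑ i ∈ s, c i * Y i ω + ∑ i ∈ s, c i * Y' i ω =
      2 * ∑ i ∈ s, c i * (D i).indicator id (Y i ω) := by
    rw [← Finset.sum_add_distrib, Finset.mul_sum]
    exact Finset.sum_congr rfl fun i _ => by simp only [Y']; ring
  have hsub : {ω | r ≤ ∑ i ∈ s, c i * (D i).indicator id (Y i ω)} ⊆
      {ω | r ≤ ∑ i ∈ s, c i * Y i ω} ∪ {ω | r ≤ ∑ i ∈ s, c i * Y' i ω} := by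
    intro ω (hω : r ≤ _)
    by_contra! hlt
    simp only [Set.mem_union, Set.mem_ofPred_eq, not_or, not_le] at hlt
    linarith [havg ω, hlt.1, hlt.2]
  calc _ ≤ P.real {ω | r ≤ ∑ i ∈ s, c i * Y i ω} + P.real {ω | r ≤ ∑ i ∈ s, c i * Y' i ω} :=
        (measureReal_mono hsub).trans (measureReal_union_le _ _)
    _ = _ := by rw [hprob, two_mul]

end SymmetricSums

section UniformTail

variable {Ω ι : Type*} [MeasurableSpace Ω] {P : Measure Ω}

/-- The finite linear combinations of the `Y i` exceed a fixed fraction of their standard deviation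
with a probability bounded away from zero. The standard deviation is written for variables that are
centred and uncorrelated. -/
def HasUniformTail (P : Measure Ω) (Y : ι → Ω → ℝ) : Prop :=
  ∃ δ > (0 : ℝ), ∃ ε > (0 : ℝ), ∀ (s : Finset ι) (c : ι → ℝ),
    δ ≤ P.real {ω | ε * √(∑ i ∈ s, c i ^ 2 * ∫ ω, Y i ω ^ 2 ∂P) ≤ ∑ i ∈ s, c i * Y i ω}

/-- Up to positive scales the variables `Y k` have the same law, which need not have a density,
unlike in `ScaledIIDRegularDensity`. -/
def IdentDistribUpToScale (P : Measure Ω) (Y : ℕ → Ω → ℝ) : Prop :=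
  ∃ lam : ℕ → ℝ, (∀ k, 0 < lam k) ∧
    ∀ k, IdentDistrib (fun ω => Y k ω / lam k) (fun ω => Y 0 ω / lam 0) P P

theorem FourthMomentBound.hasUniformTail [IsProbabilityMeasure P] {Y : ℕ → Ω → ℝ}
    (h : FourthMomentBound P Y) (hm : ∀ k, Measurable (Y k)) (hind : iIndepFun Y P)
    (hsymm : ∀ k, IdentDistrib (Y k) (fun ω => -Y k ω) P P) : HasUniformTail P Y := by
  obtain ⟨C₀, hC₀⟩ := h
  set C := max C₀ 3
  have hC : 3 ≤ C := le_max_right _ _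
  have h4 (k : ℕ) : MemLp (Y k) 4 P := by
    simpa using (memLp_natCast_iff_integrable_pow (n := 4) (by decide) (by decide)
      (hm k).aestronglyMeasurable).2 (hC₀ k).1
  have h2 (k : ℕ) : MemLp (Y k) 2 P := (h4 k).mono_exponent (by norm_num)
  have h0 (k : ℕ) := integral_eq_zero_of_identDistrib_neg (hsymm k)
  have hb (k : ℕ) : ∫ ω, Y k ω ^ 4 ∂P ≤ C * (∫ ω, Y k ω ^ 2 ∂P) ^ 2 :=
    (hC₀ k).2.trans (mul_le_mul_of_nonneg_right (le_max_left _ _) (sq_nonneg _))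
  refine ⟨9 / (32 * C), by positivity, 1 / 2, by norm_num, fun s c => ?_⟩
  have hsq := integral_sq_sum_mul (fun _ _ => hind.indepFun) h2 h0 s c
  rw [← hsq]
  refine le_measureReal_half_sqrt_le_of_pow_four_le
    (Finset.measurable_sum s fun k _ => (hm k).const_mul (c k))
    (identDistrib_neg_sum_mul hind hsymm s c)
    (memLp_finsetSum s fun k _ => (h4 k).const_mul (c k)) (by linarith) ?_
  rw [hsq]
  exact integral_pow_four_sum_mul_le hm hind h4 h0 hC hb s c

theorem FourthMomentBound.of_abs_le [IsFiniteMeasure P] {V : ℕ → Ω → ℝ}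
    (hm : ∀ k, Measurable (V k)) {M : ℕ → ℝ} (hM : ∀ k ω, |V k ω| ≤ M k) {C : ℝ}
    (hC : ∀ k, M k ^ 2 ≤ C * ∫ ω, V k ω ^ 2 ∂P) : FourthMomentBound P V := by
  have hint (k n : ℕ) : Integrable (fun ω => V k ω ^ n) P :=
    Integrable.of_bound ((hm k).pow_const n).aestronglyMeasurable (M k ^ n) (ae_of_all _ fun ω => by
      simpa only [norm_pow] using pow_le_pow_left₀ (norm_nonneg _) (hM k ω) n)
  refine ⟨C, fun k => ⟨hint k 4, ?_⟩⟩
  calc ∫ ω, V k ω ^ 4 ∂P ≤ ∫ ω, M k ^ 2 * V k ω ^ 2 ∂P := by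
        refine integral_mono (hint k 4) ((hint k 2).const_mul _) fun ω => ?_
        have hsq : V k ω ^ 2 ≤ M k ^ 2 := sq_le_sq' (abs_le.1 (hM k ω)).1 (abs_le.1 (hM k ω)).2
        calc V k ω ^ 4 = V k ω ^ 2 * V k ω ^ 2 := by ring
          _ ≤ M k ^ 2 * V k ω ^ 2 := mul_le_mul_of_nonneg_right hsq (sq_nonneg _)
    _ = M k ^ 2 * ∫ ω, V k ω ^ 2 ∂P := integral_const_mul _ _
    _ ≤ (C * ∫ ω, V k ω ^ 2 ∂P) * ∫ ω, V k ω ^ 2 ∂P :=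
        mul_le_mul_of_nonneg_right (hC k) (integral_nonneg fun ω => sq_nonneg _)
    _ = C * (∫ ω, V k ω ^ 2 ∂P) ^ 2 := by ring

theorem HasUniformTail.of_indicator [IsFiniteMeasure P] {Y : ι → Ω → ℝ} {D : ι → Set ℝ}
    (h : HasUniformTail P fun i ω => (D i).indicator id (Y i ω))
    (hm : ∀ i, Measurable (Y i)) (hind : iIndepFun Y P)
    (hsymm : ∀ i, IdentDistrib (Y i) (fun ω => -Y i ω) P P)
    (hD : ∀ i, MeasurableSet (D i)) (hneg : ∀ i y, -y ∈ D i ↔ y ∈ D i) {K : ℝ} (hK0 : 0 < K)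
    (hK : ∀ i, ∫ ω, Y i ω ^ 2 ∂P ≤ K * ∫ ω, (D i).indicator id (Y i ω) ^ 2 ∂P) :
    HasUniformTail P Y := by
  obtain ⟨δ, hδ, ε, hε, htail⟩ := h
  refine ⟨δ / 2, half_pos hδ, ε / √K, by positivity, fun s c => ?_⟩
  have hsum : ∑ i ∈ s, c i ^ 2 * ∫ ω, Y i ω ^ 2 ∂P ≤
      K * ∑ i ∈ s, c i ^ 2 * ∫ ω, (D i).indicator id (Y i ω) ^ 2 ∂P := by
    rw [Finset.mul_sum]
    refine Finset.sum_le_sum fun i _ => ?_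
    rw [mul_left_comm]
    exact mul_le_mul_of_nonneg_left (hK i) (sq_nonneg _)
  have hle : ε / √K * √(∑ i ∈ s, c i ^ 2 * ∫ ω, Y i ω ^ 2 ∂P) ≤
      ε * √(∑ i ∈ s, c i ^ 2 * ∫ ω, (D i).indicator id (Y i ω) ^ 2 ∂P) := by
    rw [div_mul_eq_mul_div, mul_div_assoc]
    refine mul_le_mul_of_nonneg_left ((div_le_iff₀' (Real.sqrt_pos.2 hK0)).2 ?_) hε.le
    rw [← Real.sqrt_mul hK0.le]
    exact Real.sqrt_le_sqrt hsum
  have htrunc := measureReal_le_sum_mul_indicator_le hm hind hsymm hD hneg s c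
    (ε / √K * √(∑ i ∈ s, c i ^ 2 * ∫ ω, Y i ω ^ 2 ∂P))
  have hδ' : δ ≤ P.real {ω | ε / √K * √(∑ i ∈ s, c i ^ 2 * ∫ ω, Y i ω ^ 2 ∂P) ≤
      ∑ i ∈ s, c i * (D i).indicator id (Y i ω)} :=
    (htail s c).trans (measureReal_mono fun ω hω => hle.trans hω)
  linarith

theorem abs_indicator_Icc_neg_le {A : ℝ} (hA : 0 ≤ A) (y : ℝ) :
    |(Set.Icc (-A) A).indicator id y| ≤ A := by
  by_cases hy : y ∈ Set.Icc (-A) A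
  · rw [Set.indicator_of_mem hy]
    exact abs_le.2 hy
  · rwa [Set.indicator_of_notMem hy, abs_zero]

theorem exists_integral_sq_indicator_Icc_pos [IsFiniteMeasure P] {Z : Ω → ℝ} (hm : Measurable Z)
    (hpos : 0 < ∫ ω, Z ω ^ 2 ∂P) :
    ∃ A ≥ (0 : ℝ), 0 < ∫ ω, (Set.Icc (-A) A).indicator id (Z ω) ^ 2 ∂P := by
  by_contra! hle
  have hzero (n : ℕ) :
      ∀ᵐ ω ∂P, (Set.Icc (-(n : ℝ)) n).indicator id (Z ω) ^ 2 = 0 := by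
    have hmeas : Measurable fun ω => (Set.Icc (-(n : ℝ)) n).indicator id (Z ω) :=
      (measurable_id.indicator measurableSet_Icc).comp hm
    have hint : Integrable (fun ω => (Set.Icc (-(n : ℝ)) n).indicator id (Z ω) ^ 2) P := by
      refine Integrable.of_bound (hmeas.pow_const 2).aestronglyMeasurable ((n : ℝ) ^ 2)
        (ae_of_all _ fun ω => ?_)
      rw [norm_pow]
      exact pow_le_pow_left₀ (norm_nonneg _) (abs_indicator_Icc_neg_le n.cast_nonneg _) 2
    exact (integral_eq_zero_iff_of_nonneg (fun ω => sq_nonneg _) hint).1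
      ((hle n n.cast_nonneg).antisymm (integral_nonneg fun ω => sq_nonneg _))
  have hZ : (fun ω => Z ω ^ 2) =ᵐ[P] 0 := by
    filter_upwards [ae_all_iff.2 hzero] with ω hω
    obtain ⟨n, hn⟩ := exists_nat_ge |Z ω|
    simpa [abs_le.1 hn] using hω n
  exact hpos.ne' (integral_eq_zero_of_ae hZ)

theorem indicator_Icc_neg_mul_self {l : ℝ} (hl : 0 < l) (A y : ℝ) :
    (Set.Icc (-(A * l)) (A * l)).indicator id y = l * (Set.Icc (-A) A).indicator id (y / l) := by
  have hmem : y / l ∈ Set.Icc (-A) A ↔ y ∈ Set.Icc (-(A * l)) (A * l) := by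
    rw [Set.mem_Icc, Set.mem_Icc, le_div_iff₀ hl, div_le_iff₀ hl, neg_mul]
  by_cases hy : y ∈ Set.Icc (-(A * l)) (A * l)
  · rw [Set.indicator_of_mem hy, Set.indicator_of_mem (hmem.2 hy), id, id, mul_div_cancel₀ y hl.ne']
  · rw [Set.indicator_of_notMem hy, Set.indicator_of_notMem (hmem.not.2 hy), mul_zero]

theorem IdentDistribUpToScale.hasUniformTail [IsProbabilityMeasure P] {Y : ℕ → Ω → ℝ}
    (h : IdentDistribUpToScale P Y) (hm : ∀ k, Measurable (Y k)) (hind : iIndepFun Y P)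
    (hsymm : ∀ k, IdentDistrib (Y k) (fun ω => -Y k ω) P P) (hpos : 0 < ∫ ω, Y 0 ω ^ 2 ∂P) :
    HasUniformTail P Y := by
  obtain ⟨lam, hlam, hident⟩ := h
  set τ := ∫ ω, (Y 0 ω / lam 0) ^ 2 ∂P with hτ
  have hsq (k : ℕ) : ∫ ω, Y k ω ^ 2 ∂P = lam k ^ 2 * τ := by
    rw [hτ, ← (hident k).sq.integral_eq]
    simp only [div_pow, integral_div]
    rw [mul_div_cancel₀ _ (pow_ne_zero 2 (hlam k).ne')]
  have hτ0 : 0 < τ := pos_of_mul_pos_right (hsq 0 ▸ hpos) (sq_nonneg _)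
  obtain ⟨A, hA, hv⟩ := exists_integral_sq_indicator_Icc_pos ((hm 0).div_const (lam 0)) hτ0
  set v := ∫ ω, (Set.Icc (-A) A).indicator id (Y 0 ω / lam 0) ^ 2 ∂P
  let D (k : ℕ) : Set ℝ := Set.Icc (-(A * lam k)) (A * lam k)
  have hsqD (k : ℕ) : ∫ ω, (D k).indicator id (Y k ω) ^ 2 ∂P = lam k ^ 2 * v := by
    simp only [D, indicator_Icc_neg_mul_self (hlam k), mul_pow, integral_const_mul]
    exact congrArg (lam k ^ 2 * ·)
      ((hident k).comp ((measurable_id.indicator measurableSet_Icc).pow_const 2)).integral_eq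
  have hneg (k : ℕ) (y : ℝ) : -y ∈ D k ↔ y ∈ D k := by
    simp only [D, Set.mem_Icc, neg_le_neg_iff, neg_le, and_comm]
  have hindicator (k : ℕ) : Measurable ((D k).indicator (id : ℝ → ℝ)) :=
    measurable_id.indicator measurableSet_Icc
  have h4 : FourthMomentBound P fun k ω => (D k).indicator id (Y k ω) :=
    .of_abs_le (fun k => (hindicator k).comp (hm k)) (M := fun k => A * lam k) (C := A ^ 2 / v)
      (fun k ω => abs_indicator_Icc_neg_le (mul_nonneg hA (hlam k).le) _) fun k => by
        rw [hsqD]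
        exact le_of_eq (by field_simp)
  have htail := h4.hasUniformTail (fun k => (hindicator k).comp (hm k))
    (hind.comp (fun k => (D k).indicator id) hindicator)
    fun k => identDistrib_neg_indicator (hsymm k) measurableSet_Icc (hneg k)
  refine htail.of_indicator hm hind hsymm (fun k => measurableSet_Icc) hneg (div_pos hτ0 hv)
    fun k => ?_
  rw [hsq, hsqD]
  exact le_of_eq (by field_simp)

end UniformTail

section HalfSpaceDepth

theorem halfSpaceDepth_pos_iff {E : Type*} [MeasurableSpace E] {T : Set (E → ℝ)} {a : E}
    {μ : Measure E} [IsFiniteMeasure μ] :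
    0 < halfSpaceDepth T a μ ↔ ∃ δ > (0 : ℝ), ∀ t ∈ T, δ ≤ μ.real {x | t a ≤ t x} := by
  constructor
  · intro h
    -- The depth is `⊤` when `T` is empty.
    refine ⟨(min (halfSpaceDepth T a μ) 1).toReal, ENNReal.toReal_pos (lt_min h one_pos).ne'
      (min_lt_of_right_lt ENNReal.one_lt_top).ne, fun t ht => ?_⟩
    exact ENNReal.toReal_mono (measure_ne_top _ _) ((min_le_left _ _).trans (iInf₂_le t ht))
  · rintro ⟨δ, hδ, h⟩
    exact (ENNReal.ofReal_pos.2 hδ).trans_le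
      (le_iInf₂ fun t ht => ENNReal.ofReal_le_of_le_toReal (h t ht))

theorem mem_finiteCombinations_iff {E : Type*} {t : ℕ → E → ℝ} {f : E → ℝ} :
    f ∈ finiteCombinations t ↔
      ∃ (s : Finset ℕ) (c : ℕ → ℝ), (fun x => ∑ k ∈ s, c k * t k x) = f := by
  have hsum (s : Finset ℕ) (c : ℕ → ℝ) : (fun x => ∑ k ∈ s, c k * t k x) = ∑ k ∈ s, c k • t k := by
    ext x
    simp only [Finset.sum_apply, Pi.smul_apply, smul_eq_mul]
  simp only [finiteCombinations, SetLike.mem_coe, hsum]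
  constructor
  · intro hf
    obtain ⟨c, rfl⟩ := Finsupp.mem_span_range_iff_exists_finsupp.1 hf
    exact ⟨c.support, c, rfl⟩
  · rintro ⟨s, c, rfl⟩
    exact Submodule.sum_mem _ fun k _ =>
      Submodule.smul_mem _ _ (Submodule.subset_span (Set.mem_range_self k))

theorem tukeyDepth_pos_iff {d : ℕ} {a : Fin d → ℝ} {μ : Measure (Fin d → ℝ)} [IsFiniteMeasure μ] :
    0 < tukeyDepth d a μ ↔
      ∃ δ > (0 : ℝ), ∀ c : Fin d → ℝ, δ ≤ μ.real {x | ∑ i, c i * a i ≤ ∑ i, c i * x i} := by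
  rw [tukeyDepth, halfSpaceDepth_pos_iff]
  simp only [Set.forall_mem_range]
  exact exists_congr fun δ => and_congr_right fun _ =>
    (dotProductEquiv ℝ (Fin d)).surjective.forall

variable {Ω B : Type*} [MeasurableSpace Ω] [MeasurableSpace B] {P : Measure Ω} [IsFiniteMeasure P]
  {X : Ω → B} {t : ℕ → B → ℝ} {a : B}

theorem halfSpaceDepth_finiteCombinations_map_pos_iff (hX : Measurable X)
    (ht : ∀ k, Measurable (t k)) :
    0 < halfSpaceDepth (finiteCombinations t) a (P.map X) ↔
      ∃ δ > (0 : ℝ), ∀ (s : Finset ℕ) (c : ℕ → ℝ),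
        δ ≤ P.real {ω | ∑ k ∈ s, c k * t k a ≤ ∑ k ∈ s, c k * t k (X ω)} := by
  have hmap (s : Finset ℕ) (c : ℕ → ℝ) :
      (P.map X).real {x | ∑ k ∈ s, c k * t k a ≤ ∑ k ∈ s, c k * t k x} =
        P.real {ω | ∑ k ∈ s, c k * t k a ≤ ∑ k ∈ s, c k * t k (X ω)} :=
    map_measureReal_apply hX (measurableSet_le measurable_const
      (Finset.measurable_sum s fun k _ => (ht k).const_mul (c k)))
  rw [halfSpaceDepth_pos_iff]
  simp only [mem_finiteCombinations_iff, forall_exists_index, ← hmap]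
  exact exists_congr fun δ => and_congr_right fun _ =>
    ⟨fun h s c => h _ s c rfl, fun h _ s c hf => hf ▸ h s c⟩

theorem positiveFiniteDimDepth_map_iff (hX : Measurable X) (ht : ∀ k, Measurable (t k)) :
    PositiveFiniteDimDepth t a (P.map X) ↔ ∀ d : ℕ, 1 ≤ d →
      ∃ δ > (0 : ℝ), ∀ c : Fin d → ℝ,
        δ ≤ P.real {ω | ∑ i, c i * t i a ≤ ∑ i, c i * t i (X ω)} := by
  refine forall₂_congr fun d _ => ?_
  have hmap (c : Fin d → ℝ) :
      ((P.map X).map fun x (i : Fin d) => t i x).real {y | ∑ i, c i * t i a ≤ ∑ i, c i * y i} =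
        P.real {ω | ∑ i, c i * t i a ≤ ∑ i, c i * t i (X ω)} := by
    have ht' : Measurable fun x (i : Fin d) => t i x := measurable_pi_lambda _ fun i => ht i
    rw [Measure.map_map ht' hX]
    exact map_measureReal_apply (ht'.comp hX) (measurableSet_le measurable_const (by fun_prop))
  simp only [tukeyDepth_pos_iff, hmap]

theorem PositiveFiniteDimDepth.exists_le_measureReal_sum_le (hX : Measurable X)
    (ht : ∀ k, Measurable (t k)) (h : PositiveFiniteDimDepth t a (P.map X)) (d : ℕ) :
    ∃ δ > (0 : ℝ), ∀ s ⊆ Finset.range d, ∀ c : ℕ → ℝ,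
      δ ≤ P.real {ω | ∑ k ∈ s, c k * t k a ≤ ∑ k ∈ s, c k * t k (X ω)} := by
  obtain ⟨δ, hδ, hδP⟩ := (positiveFiniteDimDepth_map_iff hX ht).1 h (d + 1) (Nat.le_add_left 1 d)
  refine ⟨δ, hδ, fun s hs c => ?_⟩
  have hs' : s ⊆ Finset.range (d + 1) := hs.trans (Finset.range_mono d.le_succ)
  have hsum (x : B) :
      ∑ i : Fin (d + 1), (if ↑i ∈ s then c i else 0) * t i x = ∑ k ∈ s, c k * t k x := by
    rw [← Finset.sum_range fun k => (if k ∈ s then c k else 0) * t k x]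
    simp only [ite_mul, zero_mul, Finset.sum_ite_mem, Finset.inter_eq_right.2 hs']
  simpa only [hsum] using hδP fun i => if ↑i ∈ s then c i else 0

end HalfSpaceDepth

section Summability

variable {Ω ι : Type*} [MeasurableSpace Ω] {P : Measure Ω} {Y : ι → Ω → ℝ} {b : ι → ℝ}

theorem sum_sq_div_integral_sq_le [IsFiniteMeasure P] (hind : Pairwise fun i j => Y i ⟂ᵢ[P] Y j)
    (h2 : ∀ i, MemLp (Y i) 2 P) (h0 : ∀ i, ∫ ω, Y i ω ∂P = 0)
    (hpos : ∀ i, 0 < ∫ ω, Y i ω ^ 2 ∂P) {δ : ℝ} (hδ : 0 < δ) {s : Finset ι}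
    (h : ∀ c : ι → ℝ, δ ≤ P.real {ω | ∑ i ∈ s, c i * b i ≤ ∑ i ∈ s, c i * Y i ω}) :
    ∑ i ∈ s, b i ^ 2 / ∫ ω, Y i ω ^ 2 ∂P ≤ 1 / δ := by
  set S := ∑ i ∈ s, b i ^ 2 / ∫ ω, Y i ω ^ 2 ∂P
  set c : ι → ℝ := fun i => b i / ∫ ω, Y i ω ^ 2 ∂P with hc
  have hS0 : 0 ≤ S := Finset.sum_nonneg fun i _ => div_nonneg (sq_nonneg _) (hpos i).le
  have hvalue : ∑ i ∈ s, c i * b i = S :=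
    Finset.sum_congr rfl fun i _ => by rw [hc, div_mul_eq_mul_div, ← sq]
  have hsecond : ∫ ω, (∑ i ∈ s, c i * Y i ω) ^ 2 ∂P = S := by
    rw [integral_sq_sum_mul hind h2 h0]
    refine Finset.sum_congr rfl fun i _ => ?_
    have := (hpos i).ne'
    simp only [hc]
    field_simp
  have hmarkov : S ^ 2 * P.real {ω | S ^ 2 ≤ (∑ i ∈ s, c i * Y i ω) ^ 2} ≤ S := by
    refine (mul_meas_ge_le_integral_of_nonneg (ae_of_all _ fun ω => sq_nonneg _) ?_ _).trans_eq
      hsecond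
    exact (memLp_finsetSum s fun i _ => (h2 i).const_mul (c i)).integrable_sq
  have hδS : δ ≤ P.real {ω | S ^ 2 ≤ (∑ i ∈ s, c i * Y i ω) ^ 2} :=
    (h c).trans (measureReal_mono fun ω hω => pow_le_pow_left₀ hS0 (hvalue.symm.trans_le hω) 2)
  rw [le_div_iff₀ hδ]
  rcases hS0.eq_or_lt with hzero | hSpos
  · simp [← hzero]
  · refine le_of_mul_le_mul_left ?_ hSpos
    calc S * (S * δ) = S ^ 2 * δ := by ring
      _ ≤ S * 1 := by
        rw [mul_one]
        exact (mul_le_mul_of_nonneg_left hδS (sq_nonneg S)).trans hmarkov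

theorem sum_mul_le_sqrt_sum_sq_mul_mul_sqrt_sum_sq_div {w : ι → ℝ} (hw : ∀ i, 0 < w i)
    (s : Finset ι) (c b : ι → ℝ) :
    ∑ i ∈ s, c i * b i ≤ √(∑ i ∈ s, c i ^ 2 * w i) * √(∑ i ∈ s, b i ^ 2 / w i) := by
  have hcw (i : ι) : 0 ≤ c i ^ 2 * w i := mul_nonneg (sq_nonneg _) (hw i).le
  have hbw (i : ι) : 0 ≤ b i ^ 2 / w i := div_nonneg (sq_nonneg _) (hw i).le
  rw [← Real.sqrt_mul (Finset.sum_nonneg fun i _ => hcw i)]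
  refine Real.le_sqrt_of_sq_le (Finset.sum_sq_le_sum_mul_sum_of_sq_le_mul s
    (fun i _ => hcw i) (fun i _ => hbw i) fun i _ => le_of_eq ?_)
  have := (hw i).ne'
  field_simp

theorem HasUniformTail.exists_finset_le_measureReal [IsFiniteMeasure P] (hY : HasUniformTail P Y)
    (hpos : ∀ i, 0 < ∫ ω, Y i ω ^ 2 ∂P) (hb : Summable fun i => b i ^ 2 / ∫ ω, Y i ω ^ 2 ∂P) :
    ∃ F : Finset ι, ∃ δ > (0 : ℝ), ∀ u : Finset ι, Disjoint u F → ∀ c : ι → ℝ,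
      δ ≤ P.real {ω | ∑ i ∈ u, c i * b i ≤ ∑ i ∈ u, c i * Y i ω} := by
  obtain ⟨δ, hδ, ε, hε, htail⟩ := hY
  obtain ⟨F, hF⟩ := summable_iff_vanishing_norm.1 hb (ε ^ 2) (by positivity)
  refine ⟨F, δ, hδ, fun u hu c => (htail u c).trans (measureReal_mono fun ω hω => ?_)⟩
  have hsmall : √(∑ i ∈ u, b i ^ 2 / ∫ ω, Y i ω ^ 2 ∂P) ≤ ε :=
    Real.sqrt_le_iff.2 ⟨hε.le, (le_abs_self _).trans (hF u hu).le⟩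
  calc ∑ i ∈ u, c i * b i
      ≤ √(∑ i ∈ u, c i ^ 2 * ∫ ω, Y i ω ^ 2 ∂P) * √(∑ i ∈ u, b i ^ 2 / ∫ ω, Y i ω ^ 2 ∂P) :=
        sum_mul_le_sqrt_sum_sq_mul_mul_sqrt_sum_sq_div hpos u c b
    _ ≤ √(∑ i ∈ u, c i ^ 2 * ∫ ω, Y i ω ^ 2 ∂P) * ε :=
        mul_le_mul_of_nonneg_left hsmall (Real.sqrt_nonneg _)
    _ ≤ ∑ i ∈ u, c i * Y i ω := (mul_comm _ _).trans_le hω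

theorem measureReal_le_mul_measureReal_le_le_of_indepFun [IsFiniteMeasure P] {Z W : Ω → ℝ}
    (h : Z ⟂ᵢ[P] W) (r q : ℝ) :
    P.real {ω | r ≤ Z ω} * P.real {ω | q ≤ W ω} ≤ P.real {ω | r + q ≤ Z ω + W ω} := by
  have hmul : P.real ({ω | r ≤ Z ω} ∩ {ω | q ≤ W ω}) =
      P.real {ω | r ≤ Z ω} * P.real {ω | q ≤ W ω} :=
    (congrArg ENNReal.toReal (h.measure_inter_preimage_eq_mul (Set.Ici r) (Set.Ici q)
      measurableSet_Ici measurableSet_Ici)).trans ENNReal.toReal_mul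
  refine hmul.symm.trans_le (measureReal_mono ?_)
  rintro ω ⟨hr, hq⟩
  exact add_le_add (α := ℝ) hr hq

variable {B : Type*} [MeasurableSpace B] {X : Ω → B} {t : ℕ → B → ℝ} {a : B}

theorem summable_of_halfSpaceDepth_pos [IsFiniteMeasure P] (hX : Measurable X)
    (ht : ∀ k, Measurable (t k))
    (hind : Pairwise fun j k => (fun ω => t j (X ω)) ⟂ᵢ[P] (fun ω => t k (X ω)))
    (h2 : ∀ k, MemLp (fun ω => t k (X ω)) 2 P) (h0 : ∀ k, ∫ ω, t k (X ω) ∂P = 0)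
    (hpos : ∀ k, 0 < ∫ ω, t k (X ω) ^ 2 ∂P)
    (h : 0 < halfSpaceDepth (finiteCombinations t) a (P.map X)) :
    Summable fun k => t k a ^ 2 / ∫ ω, t k (X ω) ^ 2 ∂P := by
  obtain ⟨δ, hδ, hδP⟩ := (halfSpaceDepth_finiteCombinations_map_pos_iff hX ht).1 h
  exact summable_of_sum_le (fun k => div_nonneg (sq_nonneg _) (hpos k).le)
    fun s => sum_sq_div_integral_sq_le hind h2 h0 hpos hδ (hδP s)

theorem halfSpaceDepth_pos_of_summable [IsFiniteMeasure P] (hX : Measurable X)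
    (ht : ∀ k, Measurable (t k)) (hind : iIndepFun (fun k ω => t k (X ω)) P)
    (hpos : ∀ k, 0 < ∫ ω, t k (X ω) ^ 2 ∂P) (hhead : PositiveFiniteDimDepth t a (P.map X))
    (htail : HasUniformTail P fun k ω => t k (X ω))
    (hsum : Summable fun k => t k a ^ 2 / ∫ ω, t k (X ω) ^ 2 ∂P) :
    0 < halfSpaceDepth (finiteCombinations t) a (P.map X) := by
  obtain ⟨F, δ₂, hδ₂, htailF⟩ := htail.exists_finset_le_measureReal hpos hsum
  obtain ⟨d, hd⟩ := F.exists_nat_subset_range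
  obtain ⟨δ₁, hδ₁, hheadd⟩ := hhead.exists_le_measureReal_sum_le hX ht d
  refine (halfSpaceDepth_finiteCombinations_map_pos_iff hX ht).2
    ⟨δ₁ * δ₂, mul_pos hδ₁ hδ₂, fun s c => ?_⟩
  set head := s ∩ Finset.range d
  set tail := s \ Finset.range d
  have hsplit (x : B) :
      ∑ k ∈ head, c k * t k x + ∑ k ∈ tail, c k * t k x = ∑ k ∈ s, c k * t k x :=
    Finset.sum_inter_add_sum_sdiff s (Finset.range d) fun k => c k * t k x
  have hheads := hheadd head Finset.inter_subset_right c
  have htails := htailF tail (Finset.sdiff_disjoint.mono_right hd) c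
  have hindep : (fun ω => ∑ k ∈ head, c k * t k (X ω)) ⟂ᵢ[P]
      (fun ω => ∑ k ∈ tail, c k * t k (X ω)) :=
    indepFun_sum_mul_sum_mul (fun k => (ht k).comp hX) hind
      (Finset.disjoint_sdiff_inter s (Finset.range d)).symm c
  calc δ₁ * δ₂ ≤ _ := mul_le_mul hheads htails hδ₂.le measureReal_nonneg
    _ ≤ _ := measureReal_le_mul_measureReal_le_le_of_indepFun hindep _ _
    _ = _ := by simp only [hsplit]

end Summability

section ScaledIID

variable {Ω ι : Type*} [MeasurableSpace Ω] {P : Measure Ω}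

theorem exists_le_measureReal_sum_le_of_iIndepFun [Fintype ι] [IsFiniteMeasure P] {Y : ι → Ω → ℝ}
    (hind : iIndepFun Y P) {b : ι → ℝ} (hle : ∀ i, 0 < P.real (Y i ⁻¹' Set.Iic (b i)))
    (hge : ∀ i, 0 < P.real (Y i ⁻¹' Set.Ici (b i))) :
    ∃ δ > (0 : ℝ), ∀ c : ι → ℝ, δ ≤ P.real {ω | ∑ i, c i * b i ≤ ∑ i, c i * Y i ω} := by
  refine ⟨∏ i, min (P.real (Y i ⁻¹' Set.Iic (b i))) (P.real (Y i ⁻¹' Set.Ici (b i))),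
    Finset.prod_pos fun i _ => lt_min (hle i) (hge i), fun c => ?_⟩
  let S (i : ι) : Set ℝ := if 0 ≤ c i then Set.Ici (b i) else Set.Iic (b i)
  have hS (i : ι) : MeasurableSet (S i) := by
    by_cases hc : 0 ≤ c i <;> simp only [S, hc, if_true, if_false, measurableSet_Ici,
      measurableSet_Iic]
  have hmin (i : ι) : min (P.real (Y i ⁻¹' Set.Iic (b i))) (P.real (Y i ⁻¹' Set.Ici (b i))) ≤
      P.real (Y i ⁻¹' S i) := by
    by_cases hc : 0 ≤ c i
    · simpa only [S, hc, if_true] using min_le_right _ _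
    · simpa only [S, hc, if_false] using min_le_left _ _
  have hmul {i : ι} {y : ℝ} (hy : y ∈ S i) : c i * b i ≤ c i * y := by
    by_cases hc : 0 ≤ c i
    · exact mul_le_mul_of_nonneg_left (by simpa only [S, hc, if_true, Set.mem_Ici] using hy) hc
    · exact mul_le_mul_of_nonpos_left (by simpa only [S, hc, if_false, Set.mem_Iic] using hy)
        (not_le.1 hc).le
  calc _ ≤ ∏ i, P.real (Y i ⁻¹' S i) :=
        Finset.prod_le_prod (fun i _ => (lt_min (hle i) (hge i)).le) fun i _ => hmin i
    _ = P.real (⋂ i ∈ Finset.univ, Y i ⁻¹' S i) := by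
        rw [measureReal_def, hind.measure_inter_preimage_eq_mul _ fun i _ => hS i,
          ENNReal.toReal_prod]
        rfl
    _ ≤ _ := measureReal_mono fun ω hω =>
        Finset.sum_le_sum fun i hi => hmul (Set.mem_iInter₂.1 hω i hi)

theorem IsRegularDensity.continuous {φ : ℝ → ℝ} (h : IsRegularDensity φ) : Continuous φ := by
  refine continuous_iff_continuousAt.2 fun x => ?_
  have hcont := (h.absolutelyContinuous (x - 1) (x + 1)).continuousOn
  rw [Set.uIcc_of_le (by linarith)] at hcont
  exact hcont.continuousAt (Icc_mem_nhds (by linarith) (by linarith))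

theorem IsRegularDensity.volume_absolutelyContinuous_withDensity {φ : ℝ → ℝ}
    (h : IsRegularDensity φ) : volume ≪ volume.withDensity fun x => ENNReal.ofReal (φ x) :=
  withDensity_absolutelyContinuous' h.continuous.measurable.ennreal_ofReal.aemeasurable
    (h.pos_ae.mono fun _ hx => (ENNReal.ofReal_pos.2 hx).ne')

theorem ScaledIIDRegularDensity.identDistribUpToScale {Y : ℕ → Ω → ℝ}
    (h : ScaledIIDRegularDensity P Y) : IdentDistribUpToScale P Y := by
  obtain ⟨lam, φ, hlam, -, -, hlaw⟩ := h
  exact ⟨lam, hlam, fun k => (hlaw k).identDistrib (hlaw 0)⟩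

theorem ScaledIIDRegularDensity.positiveFiniteDimDepth [IsFiniteMeasure P] {B : Type*}
    [MeasurableSpace B] {X : Ω → B} {t : ℕ → B → ℝ}
    (h : ScaledIIDRegularDensity P fun k ω => t k (X ω)) (hX : Measurable X)
    (ht : ∀ k, Measurable (t k)) (a : B) : PositiveFiniteDimDepth t a (P.map X) := by
  obtain ⟨lam, φ, hlam, hφ, hind, hlaw⟩ := h
  have hpos (k : ℕ) {A : Set ℝ} (hA : MeasurableSet A) (hA0 : volume A ≠ 0) :
      0 < P.real ((fun ω => t k (X ω) / lam k) ⁻¹' A) := by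
    have hm : Measurable fun ω => t k (X ω) / lam k := ((ht k).comp hX).div_const _
    refine ENNReal.toReal_pos (fun hzero => hA0 (hφ.volume_absolutelyContinuous_withDensity ?_))
      (measure_ne_top _ _)
    rwa [← (hlaw k).map_eq, Measure.map_apply hm hA]
  refine (positiveFiniteDimDepth_map_iff hX ht).2 fun d _ => ?_
  obtain ⟨δ, hδ, hδP⟩ := exists_le_measureReal_sum_le_of_iIndepFun
    (hind.precomp (Fin.val_injective (n := d))) (b := fun i => t i a / lam i)
    (fun i => hpos i measurableSet_Iic (by simp)) (fun i => hpos i measurableSet_Ici (by simp))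
  refine ⟨δ, hδ, fun c => ?_⟩
  have hscale (i : Fin d) (y : ℝ) : c i * lam i * (y / lam i) = c i * y := by
    have := (hlam i).ne'
    field_simp
  simpa only [Function.comp_apply, hscale] using hδP fun i => c i * lam i

end ScaledIID

theorem theorem2_general {B : Type*} [MeasurableSpace B]
    {Ω : Type*} [MeasurableSpace Ω] (P : Measure Ω) [IsProbabilityMeasure P]
    (X : Ω → B) (hX : Measurable X)
    (t : ℕ → B → ℝ) (ht : ∀ k, Measurable (t k))
    (h_indep : iIndepFun (fun k ω => t k (X ω)) P)
    (h_symm : ∀ k, IdentDistrib (fun ω => t k (X ω)) (fun ω => -t k (X ω)) P P)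
    (σ : ℕ → ℝ) (hσ : ∀ k, 0 < σ k)
    (h_memLp : ∀ k, MemLp (fun ω => t k (X ω)) 2 P)
    (h_var : ∀ k, variance (fun ω => t k (X ω)) P = σ k ^ 2)
    (a : B) (h_depth : PositiveFiniteDimDepth t a (P.map X))
    (h : FourthMomentBound P (fun k ω => t k (X ω)) ∨
      IdentDistribUpToScale P (fun k ω => t k (X ω))) :
    0 < halfSpaceDepth (finiteCombinations t) a (P.map X) ↔
      Summable (fun k => t k a ^ 2 / σ k ^ 2) := by
  have hm (k : ℕ) : Measurable fun ω => t k (X ω) := (ht k).comp hX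
  have h0 (k : ℕ) := integral_eq_zero_of_identDistrib_neg (h_symm k)
  have hsq (k : ℕ) : ∫ ω, t k (X ω) ^ 2 ∂P = σ k ^ 2 := by
    rw [← h_var k, variance_of_integral_eq_zero (hm k).aemeasurable (h0 k)]
  have hpos (k : ℕ) : 0 < ∫ ω, t k (X ω) ^ 2 ∂P := hsq k ▸ pow_pos (hσ k) 2
  have htail : HasUniformTail P fun k ω => t k (X ω) :=
    h.elim (·.hasUniformTail hm h_indep h_symm) (·.hasUniformTail hm h_indep h_symm (hpos 0))
  simp only [← hsq]
  exact ⟨summable_of_halfSpaceDepth_pos hX ht (fun _ _ => h_indep.indepFun) h_memLp h0 hpos,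
    halfSpaceDepth_pos_of_summable hX ht h_indep hpos h_depth htail⟩

theorem theorem2 {B : Type*} [AddCommGroup B] [Module ℝ B] [MetricSpace B]
    [IsTopologicalAddGroup B] [ContinuousSMul ℝ B] [CompleteSpace B]
    [TopologicalSpace.SeparableSpace B]
    (hdist : ∀ x y z : B, dist (x + z) (y + z) = dist x y)
    [MeasurableSpace B] [BorelSpace B]
    {Ω : Type*} [MeasurableSpace Ω] (P : Measure Ω) [IsProbabilityMeasure P]
    (X : Ω → B) (hX : Measurable X)
    (t : ℕ → B → ℝ) (ht : ∀ k, Measurable (t k))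
    (h_indep : iIndepFun (fun k ω => t k (X ω)) P)
    (h_symm : ∀ k, IdentDistrib (fun ω => t k (X ω)) (fun ω => -t k (X ω)) P P)
    (σ : ℕ → ℝ) (hσ : ∀ k, 0 < σ k)
    (h_memLp : ∀ k, MemLp (fun ω => t k (X ω)) 2 P)
    (h_var : ∀ k, variance (fun ω => t k (X ω)) P = σ k ^ 2)
    (a : B)
    (h : (PositiveFiniteDimDepth t a (P.map X) ∧ FourthMomentBound P (fun k ω => t k (X ω))) ∨
      ScaledIIDRegularDensity P (fun k ω => t k (X ω))) :
    0 < halfSpaceDepth (finiteCombinations t) a (P.map X) ↔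
      Summable (fun k => t k a ^ 2 / σ k ^ 2) := by
  exact theorem2_general P X hX t ht h_indep h_symm σ hσ h_memLp h_var a
    (h.elim (·.1) (·.positiveFiniteDimDepth hX ht a)) (h.imp (·.2) (·.identDistribUpToScale))
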